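/- Theorem 3.2 (generic positive definiteness, unlabeled). Let $\rho>0$, let $M\ge N\ge 1$ be integers, and let $c_0,\dots,c_{N-1}>0$ be real numbers. Put $$\mathcal C:=\sum_{j=0}^{N-1}\binom{M}{j}^2\binom{M-j-1}{N-j-1}^2\frac{\rho^{M-j}}{c_j},\qquad f(z):=\sum_{j=0}^{N-1}c_jz^j-\mathcal C^{-1}z^M .$$ Let $\mathcal P_N(\overline D(0,\rho))$ denote the set of positive semidefinite complex Hermitian $N\times N$ matrices all of whose entries lie in the closed disc $\overline D(0,\rho)=\{z\in\mathbb C:|z|\le\rho\}$. For such a matrix $A=(a_{ij})$ write $f[A]:=(f(a_{ij}))$ and $A^{\circ k}:=(a_{ij}^k)$, so that $A^{\circ 0}$ is the all-ones matrix. (1) If $N>1$ and $A\in\mathcal P_N(\overline D(0,\rho))$ has a row or a column with pairwise distinct entries, then $f[A]$ is positive definite. (2) For $A\in\mathcal P_N(\overline D(0,\rho))$, the equality $$A^{\circ M}=\mathcal C\cdot\bigl(c_0A^{\circ 0}+c_1A+\cdots+c_{N-1}A^{\circ(N-1)}\bigr)$$ holds if and only if $N=1$ and $A=(\rho)$. In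 other words, equality in the linear matrix inequality $A^{\circ M}\le\mathcal C\cdot\sum_{j=0}^{N-1}c_jA^{\circ j}$ (Loewner ordering) is never attained on $\mathcal P_N(\overline D(0,\rho))$ unless $(N,A)=(1,\rho)$. -/

import Mathlib

open scoped ComplexOrder

/-- `psdMatrices N I` is the set of positive semidefinite complex Hermitian `N × N` matrices
all of whose entries lie in `I ⊆ ℂ`. -/
def psdMatrices (N : ℕ) (I : Set ℂ) : Set (Matrix (Fin N) (Fin N) ℂ) :=
  {A | A.PosSemidef ∧ ∀ i j, A i j ∈ I}

/-- The matrix `f[A]` obtained by applying `f` to every entry of `A`. -/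
def entrywise {N : ℕ} (f : ℂ → ℂ) (A : Matrix (Fin N) (Fin N) ℂ) : Matrix (Fin N) (Fin N) ℂ :=
  Matrix.of fun i j => f (A i j)

/-- The Hadamard (entrywise) power of `A` with exponent `k`; for `k = 0` this is the matrix
with all entries equal to one. -/
def hadamardPow {N : ℕ} (A : Matrix (Fin N) (Fin N) ℂ) (k : ℕ) : Matrix (Fin N) (Fin N) ℂ :=
  entrywise (fun z => z ^ k) A

/-- The constant `∑_{j < N} binom(M, j)² binom(M - j - 1, N - j - 1)² ρ^(M - j) / c_j`.
It is used for `N ≤ M` only, where no natural-number subtraction truncates. -/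
noncomputable def threshold {N : ℕ} (c : Fin N → ℝ) (M : ℕ) (ρ : ℝ) : ℝ :=
  ∑ j : Fin N, (M.choose (j : ℕ) : ℝ) ^ 2 *
    ((M - (j : ℕ) - 1).choose (N - (j : ℕ) - 1) : ℝ) ^ 2 * (ρ ^ (M - (j : ℕ)) / c j)

/-- The polynomial function `c_0 + c_1 z + ⋯ + c_{N-1} z^(N-1) - threshold⁻¹ z^M`. -/
noncomputable def extremalPoly {N : ℕ} (c : Fin N → ℝ) (M : ℕ) (ρ : ℝ) (z : ℂ) : ℂ :=
  ∑ j : Fin N, (c j : ℂ) * z ^ (j : ℕ) - (((threshold c M ρ)⁻¹ : ℝ) : ℂ) * z ^ M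

/-! For a rank one matrix `uu*`, the quadratic form of `f[uu*]` at `x` is `∑ c_j |p_j|² - t |p_M|²`
with `p_m = ∑ x̄_k u_k^m`. Interpolating `z^M` at the `N` nodes `u_k` by a polynomial of degree less
than `N` with coefficients `a_j` gives `p_M = ∑ a_j p_j`. Weighted Cauchy–Schwarz then reduces
positivity to `t ∑ |a_j|² / c_j ≤ 1`. The coefficient bounds in `exists_interpolation_coeff` show
that this sum is at most the threshold, strictly if two nodes differ. Distinct nodes moreover
exclude `p_0 = ⋯ = p_{N-1} = 0` for `x ≠ 0` (Vandermonde), so the form is positive definite.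

For general `A`, split off a rank one part `B = uu*` with the same `i`-th column. Then `f[A] - f[B]`
is the integral over `s ∈ [0, 1]` of `(A - B) ∘ f'[B + s(A - B)]`. Row and column `i` of `A - B`
vanish, so the Schur product theorem and induction on `N`, applied to `f'`, make the integrand
positive semidefinite. `threshold_deriv_le` passes the bound on `t` to `f'`. If column `i` has
distinct entries, so does `u`, and `f[A]` inherits definiteness from `f[B]`.

Equality is excluded for `N > 1` by looking at a single diagonal entry. -/

/-! ### Interpolation of powers and coefficient bounds -/

open Polynomial in
/-- The remainder of `X ^ (N + d - 1)` modulo `∏ i < N, (X - u i)`. -/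
noncomputable def powRemainder (u : ℕ → ℂ) : ℕ → ℕ → ℂ[X]
  | 0, _ => 0
  | N + 1, 0 => X ^ N
  | N + 1, d + 1 => C (u N) * powRemainder u (N + 1) d + (X - C (u N)) * powRemainder u N (d + 1)

/-- The recursion reflects `X^(m+1) = u_N X^m + (X - u_N) X^m`: the factor `X - u_N` vanishes at the
new node, so the second `X^m` need only be right at the first `N` nodes. -/
theorem powRemainder_eval (u : ℕ → ℂ) (N d M : ℕ) (h : N + d = M + 1) {i : ℕ} (hi : i < N) :
    (powRemainder u N d).eval (u i) = u i ^ M := by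
  induction N generalizing d M with
  | zero => omega
  | succ N ihN =>
    induction d generalizing M with
    | zero =>
      obtain rfl : M = N := by omega
      simp [powRemainder]
    | succ d ihd =>
      obtain ⟨M, rfl⟩ : ∃ M', M = M' + 1 := ⟨N + d, by omega⟩
      have h1 := ihd M (by omega)
      rcases Nat.lt_succ_iff_lt_or_eq.mp hi with hlt | rfl
      · have h2 := ihN (d + 1) M (by omega) hlt
        simp only [powRemainder, Polynomial.eval_add, Polynomial.eval_mul, Polynomial.eval_sub,
          Polynomial.eval_C, Polynomial.eval_X, h1, h2]
        ring
      · simp only [powRemainder, Polynomial.eval_add, Polynomial.eval_mul, Polynomial.eval_sub,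
          Polynomial.eval_C, Polynomial.eval_X, h1]
        ring

theorem powRemainder_coeff_zero (u : ℕ → ℂ) (N d : ℕ) :
    (powRemainder u (N + 1) (d + 1)).coeff 0 =
      u N * ((powRemainder u (N + 1) d).coeff 0 - (powRemainder u N (d + 1)).coeff 0) := by
  simp [powRemainder, sub_mul]
  ring

theorem powRemainder_coeff_succ (u : ℕ → ℂ) (N d j : ℕ) :
    (powRemainder u (N + 1) (d + 1)).coeff (j + 1) =
      u N * ((powRemainder u (N + 1) d).coeff (j + 1) -
        (powRemainder u N (d + 1)).coeff (j + 1)) + (powRemainder u N (d + 1)).coeff j := by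
  simp [powRemainder, sub_mul]
  ring

theorem powRemainder_coeff_eq_zero (u : ℕ → ℂ) (N d : ℕ) {j : ℕ} (hj : N ≤ j) :
    (powRemainder u N d).coeff j = 0 := by
  induction N generalizing d j with
  | zero => simp [powRemainder]
  | succ N ihN =>
    obtain ⟨j, rfl⟩ : ∃ j', j = j' + 1 := ⟨j - 1, by omega⟩
    induction d with
    | zero =>
      simp only [powRemainder, Polynomial.coeff_X_pow]
      exact if_neg (by omega)
    | succ d ihd =>
      rw [powRemainder_coeff_succ, ihd, ihN _ (by omega), ihN _ (by omega)]
      simp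

theorem norm_powRemainder_coeff_le (u : ℕ → ℂ) {r : ℝ} (hr : 0 ≤ r) (N d M : ℕ)
    (h : N + d = M + 1) (hu : ∀ i < N, ‖u i‖ ≤ r) {j : ℕ} (hj : j < N) :
    ‖(powRemainder u N d).coeff j‖ ≤
      M.choose j * (M - j - 1).choose (N - j - 1) * r ^ (M - j) := by
  induction N generalizing d M j with
  | zero => omega
  | succ N ihN =>
    induction d generalizing M j with
    | zero =>
      obtain rfl : M = N := by omega
      simp only [powRemainder, Polynomial.coeff_X_pow]
      split_ifs with hjM
      · subst hjM; simp
      · simp; positivity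
    | succ d ihd =>
      obtain ⟨M, rfl⟩ : ∃ M', M = M' + 1 := ⟨N + d, by omega⟩
      -- Pascal's rule in the second binomial adds the two inductive bounds. For `k = N` the
      -- remainder on `N` nodes contributes nothing.
      have hsum : ∀ k ≤ N, ‖(powRemainder u (N + 1) d).coeff k‖ +
          ‖(powRemainder u N (d + 1)).coeff k‖ ≤
          M.choose k * (M - k).choose (N - k) * r ^ (M - k) := by
        intro k hk
        have h1 := ihd M (j := k) (by omega) (by omega)
        rcases hk.lt_or_eq with hlt | rfl
        · have h2 := ihN (d + 1) M (by omega) (fun i hi => hu i (by omega)) hlt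
          obtain ⟨p, hp⟩ : ∃ p, M - k = p + 1 := ⟨M - k - 1, by omega⟩
          obtain ⟨q, hq⟩ : ∃ q, N - k = q + 1 := ⟨N - k - 1, by omega⟩
          have hN1 : N + 1 - k - 1 = q + 1 := by omega
          rw [hN1] at h1
          rw [hq, Nat.add_sub_cancel] at h2
          rw [hp] at h1 h2 ⊢
          rw [Nat.add_sub_cancel] at h1 h2
          rw [hq, Nat.choose_succ_succ' p q]
          push_cast
          linarith
        · rw [powRemainder_coeff_eq_zero u k (d + 1) le_rfl, norm_zero, add_zero]
          simpa using h1
      have huN := hu N (by omega)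
      have hmul : ∀ k ≤ N, ‖u N * ((powRemainder u (N + 1) d).coeff k -
          (powRemainder u N (d + 1)).coeff k)‖ ≤
          M.choose k * (M - k).choose (N - k) * r ^ (M + 1 - k) := by
        intro k hk
        rw [norm_mul, Nat.sub_add_comm (by omega : k ≤ M), pow_succ]
        calc _ ≤ r * (M.choose k * (M - k).choose (N - k) * r ^ (M - k)) := by
              gcongr
              exact (norm_sub_le _ _).trans (hsum k hk)
          _ = _ := by ring
      cases j with
      | zero =>
        rw [powRemainder_coeff_zero]
        simpa using hmul 0 (by omega)
      | succ j =>
        rw [powRemainder_coeff_succ]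
        have h1 := hmul (j + 1) (by omega)
        have h2 := ihN (d + 1) M (by omega) (fun i hi => hu i (by omega)) (by omega : j < N)
        have e1 : M + 1 - (j + 1) - 1 = M - (j + 1) := by omega
        have e2 : N + 1 - (j + 1) - 1 = N - (j + 1) := by omega
        have e3 : M + 1 - (j + 1) = M - j := by omega
        -- Pascal's rule in the first binomial separates the `u N` term from the shifted
        -- coefficient.
        rw [e1, e2, Nat.choose_succ_succ' M j]
        rw [e3] at h1 ⊢
        have e4 : M - j - 1 = M - (j + 1) := by omega
        have e5 : N - j - 1 = N - (j + 1) := by omega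
        rw [e4, e5] at h2
        push_cast
        refine (norm_add_le _ _).trans ?_
        linarith

theorem powRemainder_one_coeff (u : ℕ → ℂ) (N : ℕ) :
    (powRemainder u (N + 1) 1).coeff N = ∑ i ∈ Finset.range (N + 1), u i := by
  induction N with
  | zero => simp [powRemainder]
  | succ N ih =>
    rw [powRemainder_coeff_succ, ih, powRemainder_coeff_eq_zero u (N + 1) _ le_rfl,
      Finset.sum_range_succ _ (N + 1)]
    simp [powRemainder]
    ring

theorem norm_sum_lt_card_mul {ι : Type*} [DecidableEq ι] (s : Finset ι) (u : ι → ℂ) {r : ℝ}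
    (hu : ∀ i ∈ s, ‖u i‖ ≤ r) {a b : ι} (ha : a ∈ s) (hb : b ∈ s) (hab : u a ≠ u b) :
    ‖∑ i ∈ s, u i‖ < s.card * r := by
  have hne : b ≠ a := fun h => hab (by rw [h])
  have hb' : b ∈ s.erase a := Finset.mem_erase.mpr ⟨hne, hb⟩
  -- Strict convexity of the disc: the midpoint of two distinct points has norm less than `r`.
  have h2 : ‖u a + u b‖ < 2 * r := by
    have := norm_combo_lt_of_ne (hu a ha) (hu b hb) hab (a := 1 / 2) (b := 1 / 2)
      (by norm_num) (by norm_num) (by norm_num)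
    rw [← smul_add, norm_smul] at this
    norm_num at this
    linarith
  have h3 : ‖∑ i ∈ (s.erase a).erase b, u i‖ ≤ ((s.erase a).erase b).card * r := by
    simpa using norm_sum_le_of_le _ (fun i hi =>
      hu i (Finset.mem_of_mem_erase (Finset.mem_of_mem_erase hi)))
  rw [← Finset.add_sum_erase s u ha, ← Finset.add_sum_erase _ u hb', ← add_assoc]
  have hc : (s.card : ℝ) = ((s.erase a).erase b).card + 2 := by
    rw [← Finset.card_erase_add_one ha, ← Finset.card_erase_add_one hb']
    push_cast
    ring
  calc _ ≤ _ := norm_add_le _ _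
    _ < 2 * r + ((s.erase a).erase b).card * r := by linarith
    _ = _ := by rw [hc]; ring

/-- The top coefficient is the complete homogeneous symmetric polynomial of degree `d + 1` in the
nodes, and the bound counts its monomials. Induction on `d` alone keeps all nodes, hence the
distinct pair. Strictness starts from the sum of the nodes at `d = 0`. -/
theorem norm_powRemainder_coeff_lt (u : ℕ → ℂ) {r : ℝ} (hr : 0 < r) (N d : ℕ)
    (hu : ∀ i < N + 1, ‖u i‖ ≤ r) {a b : ℕ} (ha : a < N + 1) (hb : b < N + 1) (hab : u a ≠ u b) :
    ‖(powRemainder u (N + 1) (d + 1)).coeff N‖ < (N + d + 1).choose N * r ^ (d + 1) := by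
  induction d with
  | zero =>
    rw [powRemainder_one_coeff]
    simpa using norm_sum_lt_card_mul (Finset.range (N + 1)) u (r := r) (by simpa using hu)
      (by simpa using ha) (by simpa using hb) hab
  | succ d ih =>
    cases N with
    | zero => exact absurd (by congr 1; omega) hab
    | succ N =>
      rw [powRemainder_coeff_succ, powRemainder_coeff_eq_zero u (N + 1) _ le_rfl, sub_zero]
      have h2 := norm_powRemainder_coeff_le u hr.le (N + 1) (d + 2) (N + d + 2) (by omega)
        (fun i hi => hu i (by omega)) (by omega : N < N + 1)
      have e : N + d + 2 - N = d + 2 := by omega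
      rw [e, show N + 1 - N - 1 = 0 by omega, Nat.choose_zero_right, Nat.cast_one, mul_one] at h2
      have h1 : ‖u (N + 1) * (powRemainder u (N + 1 + 1) (d + 1)).coeff (N + 1)‖ <
          r * ((N + 1 + d + 1).choose (N + 1) * r ^ (d + 1)) := by
        rw [norm_mul]
        calc _ ≤ r * ‖(powRemainder u (N + 1 + 1) (d + 1)).coeff (N + 1)‖ := by
              gcongr
              exact hu _ (by omega)
          _ < _ := by gcongr
      refine (norm_add_le _ _).trans_lt ((add_lt_add_of_lt_of_le h1 h2).trans_eq ?_)
      rw [show N + 1 + (d + 1) + 1 = (N + d + 2) + 1 by ring,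
        show N + 1 + d + 1 = N + d + 2 by ring, Nat.choose_succ_succ' (N + d + 2) N]
      push_cast
      ring

/-- Interpolation of `z ^ M` at the nodes `u i` by a polynomial of degree less than `N`, with
bounds on its coefficients. -/
theorem exists_interpolation_coeff {N M : ℕ} (hNM : N ≤ M) (u : Fin N → ℂ) {r : ℝ} (hr : 0 < r)
    (hu : ∀ i, ‖u i‖ ≤ r) :
    ∃ a : Fin N → ℂ, (∀ i, u i ^ M = ∑ j : Fin N, a j * u i ^ (j : ℕ)) ∧
      (∀ j : Fin N, ‖a j‖ ≤
        M.choose (j : ℕ) * (M - (j : ℕ) - 1).choose (N - (j : ℕ) - 1) * r ^ (M - (j : ℕ))) ∧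
      ((∃ i k, u i ≠ u k) → ∃ j : Fin N, ‖a j‖ <
        M.choose (j : ℕ) * (M - (j : ℕ) - 1).choose (N - (j : ℕ) - 1) * r ^ (M - (j : ℕ))) := by
  set v : ℕ → ℂ := fun k => if h : k < N then u ⟨k, h⟩ else 0 with hv
  have hvu : ∀ i : Fin N, v i = u i := fun i => by simp [hv]
  have hvr : ∀ i < N, ‖v i‖ ≤ r := fun i hi => by simpa [hvu ⟨i, hi⟩] using hvu ⟨i, hi⟩ ▸ hu ⟨i, hi⟩
  have hd : N + (M + 1 - N) = M + 1 := by omega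
  refine ⟨fun j => (powRemainder v N (M + 1 - N)).coeff j, fun i => ?_, fun j => ?_, ?_⟩
  · rw [← hvu, ← powRemainder_eval v N _ M hd i.2]
    rcases N with _ | N
    · exact i.elim0
    · rw [Polynomial.eval_eq_sum_range' (n := N + 1), ← Fin.sum_univ_eq_sum_range
        (fun j => (powRemainder v (N + 1) (M + 1 - (N + 1))).coeff j * v i ^ j)]
      rw [Nat.lt_succ_iff, Polynomial.natDegree_le_iff_coeff_eq_zero]
      exact fun j hj => powRemainder_coeff_eq_zero _ _ _ (by omega)
  · exact norm_powRemainder_coeff_le v hr.le N _ M hd hvr j.2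
  · rintro ⟨i, k, hik⟩
    rcases N with _ | N
    · exact i.elim0
    · obtain ⟨d, rfl⟩ : ∃ d, M = N + d + 1 := ⟨M - (N + 1), by omega⟩
      refine ⟨Fin.last N, ?_⟩
      have := norm_powRemainder_coeff_lt v hr N d hvr i.2 k.2 (by simpa [hvu] using hik)
      have e : N + d + 1 + 1 - (N + 1) = d + 1 := by omega
      have e' : N + d + 1 - N = d + 1 := by omega
      simpa [e, e'] using this

/-! ### Rank one matrices -/

/-- The polynomial function `∑ j < N, c j * z ^ j - t * z ^ M`. -/
noncomputable def perturbedPoly {N : ℕ} (c : Fin N → ℝ) (t : ℝ) (M : ℕ) (z : ℂ) : ℂ :=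
  ∑ j : Fin N, (c j : ℂ) * z ^ (j : ℕ) - (t : ℂ) * z ^ M

theorem star_perturbedPoly {N : ℕ} (c : Fin N → ℝ) (t : ℝ) (M : ℕ) (z : ℂ) :
    star (perturbedPoly c t M z) = perturbedPoly c t M (star z) := by
  simp [perturbedPoly]

theorem entrywise_perturbedPoly_isHermitian {n N : ℕ} (c : Fin N → ℝ) (t : ℝ) (M : ℕ)
    {A : Matrix (Fin n) (Fin n) ℂ} (hA : A.IsHermitian) :
    (entrywise (perturbedPoly c t M) A).IsHermitian := by
  ext i j
  simp only [Matrix.conjTranspose_apply, entrywise, Matrix.of_apply, star_perturbedPoly, hA.apply]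

theorem star_dotProduct_mulVec_eq_sum {n : ℕ} (A : Matrix (Fin n) (Fin n) ℂ) (x : Fin n → ℂ) :
    star x ⬝ᵥ (A.mulVec x) = ∑ k, ∑ l, star (x k) * A k l * x l := by
  simp [dotProduct, Matrix.mulVec, Finset.mul_sum, mul_assoc]

theorem quadraticForm_hadamardPow_rankOne {n : ℕ} (u x : Fin n → ℂ) (m : ℕ) :
    ∑ k, ∑ l, star (x k) * (u k * star (u l)) ^ m * x l =
      ((‖∑ k, star (x k) * u k ^ m‖ ^ 2 : ℝ) : ℂ) := by
  rw [Complex.ofReal_pow, ← Complex.mul_conj', map_sum, Finset.sum_mul_sum]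
  refine Finset.sum_congr rfl fun k _ => Finset.sum_congr rfl fun l _ => ?_
  simp [mul_pow]
  ring

theorem quadraticForm_perturbedPoly_rankOne {n N : ℕ} (c : Fin N → ℝ) (t : ℝ) (M : ℕ)
    (u x : Fin n → ℂ) :
    star x ⬝ᵥ ((entrywise (perturbedPoly c t M) (Matrix.vecMulVec u (star u))).mulVec x) =
      ((∑ j : Fin N, c j * ‖∑ k, star (x k) * u k ^ (j : ℕ)‖ ^ 2 -
        t * ‖∑ k, star (x k) * u k ^ M‖ ^ 2 : ℝ) : ℂ) := by
  rw [star_dotProduct_mulVec_eq_sum]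
  push_cast
  simp_rw [← Complex.ofReal_pow, ← quadraticForm_hadamardPow_rankOne]
  simp only [entrywise, Matrix.of_apply, Matrix.vecMulVec_apply, perturbedPoly, Pi.star_apply,
    mul_sub, sub_mul, Finset.sum_sub_distrib, Finset.mul_sum, Finset.sum_mul]
  congr 1
  · symm
    rw [Finset.sum_comm]
    refine Finset.sum_congr rfl fun k _ => ?_
    rw [Finset.sum_comm]
    refine Finset.sum_congr rfl fun l _ => Finset.sum_congr rfl fun j _ => ?_
    ring
  · refine Finset.sum_congr rfl fun k _ => Finset.sum_congr rfl fun l _ => ?_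
    ring

/-- Cauchy–Schwarz after writing `a_j p_j = (a_j / √c_j)(√c_j p_j)`. -/
theorem norm_sum_mul_sq_le {ι : Type*} (s : Finset ι) (c : ι → ℝ) (hc : ∀ j ∈ s, 0 < c j)
    (a p : ι → ℂ) :
    ‖∑ j ∈ s, a j * p j‖ ^ 2 ≤ (∑ j ∈ s, ‖a j‖ ^ 2 / c j) * ∑ j ∈ s, c j * ‖p j‖ ^ 2 := by
  calc ‖∑ j ∈ s, a j * p j‖ ^ 2 ≤ (∑ j ∈ s, ‖a j‖ * ‖p j‖) ^ 2 := by
        gcongr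
        refine (norm_sum_le _ _).trans_eq ?_
        simp
    _ ≤ _ := by
        refine Finset.sum_sq_le_sum_mul_sum_of_sq_le_mul s ?_ ?_ ?_
        · intro j hj; have := hc j hj; positivity
        · intro j hj; have := hc j hj; positivity
        · intro j hj
          have := (hc j hj).ne'
          exact le_of_eq (by field_simp)

/-- The nodes satisfy `|u_k| ≤ √ρ`, so each threshold term is a squared coefficient bound with `r =
√ρ`, divided by `c_j`. -/
theorem threshold_term_eq {N : ℕ} (c : Fin N → ℝ) (M : ℕ) {ρ : ℝ} (hρ : 0 < ρ) (j : Fin N) :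
    (M.choose (j : ℕ) : ℝ) ^ 2 * ((M - (j : ℕ) - 1).choose (N - (j : ℕ) - 1) : ℝ) ^ 2 *
      (ρ ^ (M - (j : ℕ)) / c j) =
    (M.choose (j : ℕ) * (M - (j : ℕ) - 1).choose (N - (j : ℕ) - 1) *
      √ρ ^ (M - (j : ℕ))) ^ 2 / c j := by
  rw [mul_pow, mul_pow, ← pow_mul, mul_comm (M - (j : ℕ)) 2, pow_mul, Real.sq_sqrt hρ.le]
  ring

theorem sum_norm_sq_div_le_threshold {N : ℕ} (c : Fin N → ℝ) (hc : ∀ j, 0 < c j) (M : ℕ) {ρ : ℝ}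
    (hρ : 0 < ρ) (a : Fin N → ℂ)
    (ha : ∀ j : Fin N, ‖a j‖ ≤
      M.choose (j : ℕ) * (M - (j : ℕ) - 1).choose (N - (j : ℕ) - 1) * √ρ ^ (M - (j : ℕ))) :
    ∑ j, ‖a j‖ ^ 2 / c j ≤ threshold c M ρ := by
  refine Finset.sum_le_sum fun j _ => ?_
  rw [threshold_term_eq c M hρ]
  have := hc j
  gcongr
  exact ha j

theorem sum_norm_sq_div_lt_threshold {N : ℕ} (c : Fin N → ℝ) (hc : ∀ j, 0 < c j) (M : ℕ) {ρ : ℝ}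
    (hρ : 0 < ρ) (a : Fin N → ℂ)
    (ha : ∀ j : Fin N, ‖a j‖ ≤
      M.choose (j : ℕ) * (M - (j : ℕ) - 1).choose (N - (j : ℕ) - 1) * √ρ ^ (M - (j : ℕ)))
    (ha' : ∃ j : Fin N, ‖a j‖ <
      M.choose (j : ℕ) * (M - (j : ℕ) - 1).choose (N - (j : ℕ) - 1) * √ρ ^ (M - (j : ℕ))) :
    ∑ j, ‖a j‖ ^ 2 / c j < threshold c M ρ := by
  obtain ⟨j, hj⟩ := ha'
  refine Finset.sum_lt_sum (fun j _ => ?_) ⟨j, Finset.mem_univ j, ?_⟩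
  all_goals
    rw [threshold_term_eq c M hρ]
    have := hc j
    gcongr
  exact ha j

theorem sum_star_mul_pow_eq {n N M : ℕ} (u x : Fin n → ℂ) (a : Fin N → ℂ)
    (ha : ∀ i, u i ^ M = ∑ j : Fin N, a j * u i ^ (j : ℕ)) :
    ∑ k, star (x k) * u k ^ M = ∑ j : Fin N, a j * ∑ k, star (x k) * u k ^ (j : ℕ) := by
  simp_rw [ha, Finset.mul_sum]
  rw [Finset.sum_comm]
  refine Finset.sum_congr rfl fun k _ => Finset.sum_congr rfl fun l _ => ?_
  ring

theorem perturbedPoly_rankOne_posSemidef {N M : ℕ} (hNM : N ≤ M) (c : Fin N → ℝ)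
    (hc : ∀ j, 0 < c j) {ρ t : ℝ} (hρ : 0 < ρ) (ht : 0 ≤ t) (htc : t * threshold c M ρ ≤ 1)
    (u : Fin N → ℂ) (hu : ∀ i, ‖u i‖ ≤ √ρ) :
    (entrywise (perturbedPoly c t M) (Matrix.vecMulVec u (star u))).PosSemidef := by
  refine .of_dotProduct_mulVec_nonneg (entrywise_perturbedPoly_isHermitian c t M
    (Matrix.posSemidef_vecMulVec_self_star u).1) fun x => ?_
  rw [quadraticForm_perturbedPoly_rankOne, Complex.zero_le_real, sub_nonneg]
  obtain ⟨a, ha, hle, -⟩ := exists_interpolation_coeff hNM u (Real.sqrt_pos.mpr hρ) hu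
  rw [sum_star_mul_pow_eq u x a ha]
  set S := ∑ j : Fin N, c j * ‖∑ k, star (x k) * u k ^ (j : ℕ)‖ ^ 2 with hS
  have hS0 : 0 ≤ S := Finset.sum_nonneg fun j _ => mul_nonneg (hc j).le (sq_nonneg _)
  calc _ ≤ t * ((∑ j, ‖a j‖ ^ 2 / c j) * S) := by
        gcongr
        exact norm_sum_mul_sq_le _ c (fun j _ => hc j) a _
    _ ≤ t * (threshold c M ρ * S) := by
        gcongr
        exact sum_norm_sq_div_le_threshold c hc M hρ a hle
    _ = t * threshold c M ρ * S := by ring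
    _ ≤ 1 * S := by gcongr
    _ = S := one_mul S

theorem perturbedPoly_rankOne_posDef {N M : ℕ} (hN : 1 < N) (hNM : N ≤ M) (c : Fin N → ℝ)
    (hc : ∀ j, 0 < c j) {ρ t : ℝ} (hρ : 0 < ρ) (ht : 0 ≤ t) (htc : t * threshold c M ρ ≤ 1)
    (u : Fin N → ℂ) (hu : ∀ i, ‖u i‖ ≤ √ρ) (hinj : Function.Injective u) :
    (entrywise (perturbedPoly c t M) (Matrix.vecMulVec u (star u))).PosDef := by
  refine .of_dotProduct_mulVec_pos (entrywise_perturbedPoly_isHermitian c t M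
    (Matrix.posSemidef_vecMulVec_self_star u).1) fun x hx => ?_
  rw [quadraticForm_perturbedPoly_rankOne, Complex.zero_lt_real, sub_pos]
  obtain ⟨a, ha, hle, hlt⟩ := exists_interpolation_coeff hNM u (Real.sqrt_pos.mpr hρ) hu
  have hlt := sum_norm_sq_div_lt_threshold c hc M hρ a hle
    (hlt ⟨⟨0, by omega⟩, ⟨1, hN⟩, fun h => by simpa using hinj h⟩)
  rw [sum_star_mul_pow_eq u x a ha]
  set S := ∑ j : Fin N, c j * ‖∑ k, star (x k) * u k ^ (j : ℕ)‖ ^ 2 with hS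
  have hS0 : 0 < S := by
    have hnn : ∀ j ∈ Finset.univ, 0 ≤ c j * ‖∑ k, star (x k) * u k ^ (j : ℕ)‖ ^ 2 :=
      fun j _ => mul_nonneg (hc j).le (sq_nonneg _)
    refine (Finset.sum_nonneg hnn).lt_of_ne fun h0 => hx ?_
    have hz := (Finset.sum_eq_zero_iff_of_nonneg hnn).mp h0.symm
    -- Invertibility of the Vandermonde matrix on distinct nodes.
    have hxs : (fun k => star (x k)) = 0 :=
      Matrix.eq_zero_of_forall_pow_sum_mul_pow_eq_zero hinj fun j => by
        simpa [(hc j).ne'] using hz j (Finset.mem_univ j)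
    funext k
    simpa using congrFun hxs k
  -- The strict inequality below survives multiplication by `t` only for `t > 0`.
  rcases ht.eq_or_lt with rfl | ht
  · simpa using hS0
  calc _ ≤ t * ((∑ j, ‖a j‖ ^ 2 / c j) * S) := by
        gcongr
        exact norm_sum_mul_sq_le _ c (fun j _ => hc j) a _
    _ < t * (threshold c M ρ * S) := by gcongr
    _ = t * threshold c M ρ * S := by ring
    _ ≤ 1 * S := by gcongr
    _ = S := one_mul S

/-! ### Splitting off a rank one part -/

theorem posSemidef_diag_eq_zero {n : ℕ} {A : Matrix (Fin n) (Fin n) ℂ} (hA : A.PosSemidef)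
    {i : Fin n} (hi : A i i = 0) (k : Fin n) : A k i = 0 := by
  have h := (hA.dotProduct_mulVec_zero_iff (Pi.single i 1)).mp (by simp [hi])
  simpa using congrFun h k

/-- Splitting off a rank one part that carries the `i`-th column. -/
theorem exists_rankOne_sub_posSemidef {n : ℕ} {A : Matrix (Fin n) (Fin n) ℂ} (hA : A.PosSemidef)
    (i : Fin n) :
    ∃ u : Fin n → ℂ, (A - Matrix.vecMulVec u (star u)).PosSemidef ∧
      ∀ k, u k * star (u i) = A k i := by
  have ha := hA.diag_nonneg (i := i)
  obtain ⟨hre, him⟩ := Complex.nonneg_iff.mp ha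
  by_cases h0 : A i i = 0
  · exact ⟨0, by simpa using hA, fun k => by simp [posSemidef_diag_eq_zero hA h0 k]⟩
  set s : ℝ := √(A i i).re with hs
  have hss : (s : ℂ) * s = A i i := by
    rw [← Complex.ofReal_mul, Real.mul_self_sqrt hre]
    exact Complex.ext (by simp) (by simp [him])
  have hs0 : (s : ℂ) ≠ 0 := fun h => h0 (by rw [← hss, h, zero_mul])
  refine ⟨fun k => A k i / s, ?_, fun k => ?_⟩
  -- `A - uu* = P* A P`, where `P = 1 - a_ii⁻¹ e_i e_i* A` is the projection along `e_i`, orthogonal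
  -- for the form of `A`.
  · have hP := hA.conjTranspose_mul_mul_same
      (1 - (A i i)⁻¹ • Matrix.vecMulVec (Pi.single i 1) (A i))
    convert hP using 1
    have hherm := hA.1
    have key : A * (1 - (A i i)⁻¹ • Matrix.vecMulVec (Pi.single i 1) (A i)) =
        A - (A i i)⁻¹ • Matrix.vecMulVec (fun k => A k i) (A i) := by
      rw [mul_sub, mul_one, Matrix.mul_smul, Matrix.mul_vecMulVec, Matrix.mulVec_single_one]
      rfl
    rw [Matrix.mul_assoc, key]
    ext k l
    have hki : star (A i k) = A k i := hherm.apply k i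
    have hli : star (A l i) = A i l := hherm.apply i l
    have haa : star (A i i) = A i i := hherm.apply i i
    have hli' : (starRingEnd ℂ) (A l i) = A i l := hli
    simp only [Matrix.conjTranspose_sub, Matrix.conjTranspose_one, Matrix.conjTranspose_smul,
      sub_mul, one_mul, Matrix.sub_apply, Matrix.smul_mul, Matrix.smul_apply,
      Matrix.conjTranspose_vecMulVec, Matrix.vecMulVec_mul, Matrix.vecMulVec_apply,
      Pi.star_apply, smul_eq_mul, star_inv₀, haa, hki]
    simp [Matrix.vecMulVec_apply, Matrix.vecMul, hli', ← hss]
    field_simp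
    ring
  · have : star (A i i / (s : ℂ)) = s := by
      rw [star_div₀, hA.1.apply i i, ← hss]
      simp [hs0]
    rw [this]
    field_simp

theorem posSemidef_of_zero_row {n : ℕ} {H : Matrix (Fin (n + 1)) (Fin (n + 1)) ℂ} (i : Fin (n + 1))
    (hr : ∀ k, H i k = 0) (hcol : ∀ k, H k i = 0)
    (hH : (H.submatrix i.succAbove i.succAbove).PosSemidef) : H.PosSemidef := by
  refine .of_dotProduct_mulVec_nonneg ?_ fun x => ?_
  · ext k l
    rcases Fin.eq_self_or_eq_succAbove i k with rfl | ⟨k, rfl⟩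
    · simp [hr, hcol]
    rcases Fin.eq_self_or_eq_succAbove i l with rfl | ⟨l, rfl⟩
    · simp [hr, hcol]
    exact hH.1.apply k l
  · rw [star_dotProduct_mulVec_eq_sum, Fin.sum_univ_succAbove _ i]
    simp_rw [Fin.sum_univ_succAbove _ i, hr, hcol]
    have := hH.dotProduct_mulVec_nonneg (x ∘ i.succAbove)
    rw [star_dotProduct_mulVec_eq_sum] at this
    simpa using this

/-! ### Differentiation and induction on the dimension -/

/-- The constant term disappears, so the derivative has the same shape with `N` and `M` lowered by
one; this drives the induction. -/
theorem hasDerivAt_perturbedPoly {N : ℕ} (c : Fin (N + 1) → ℝ) (t : ℝ) (M : ℕ) (z : ℂ) :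
    HasDerivAt (perturbedPoly c t (M + 1))
      (perturbedPoly (fun j : Fin N => ((j : ℕ) + 1) * c j.succ) (t * (M + 1)) M z) z := by
  have h1 : HasDerivAt (fun z : ℂ => ∑ j : Fin (N + 1), (c j : ℂ) * z ^ (j : ℕ))
      (∑ j : Fin (N + 1), (c j : ℂ) * (((j : ℕ) : ℂ) * z ^ ((j : ℕ) - 1))) z :=
    HasDerivAt.fun_sum fun j _ => (hasDerivAt_pow _ z).const_mul _
  have h2 := h1.sub ((hasDerivAt_pow (M + 1) z).const_mul (t : ℂ))
  refine h2.congr_deriv ?_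
  rw [Fin.sum_univ_succ, perturbedPoly]
  simp only [Fin.val_zero, Fin.val_succ, Nat.add_sub_cancel]
  push_cast
  simp only [zero_mul, mul_zero, zero_add]
  congr 1
  · exact Finset.sum_congr rfl fun j _ => by ring
  · ring

/-- The `s`-derivative of `g[B + sD]` is `D ∘ g'[B + sD]`. Monotonicity of the quadratic form
replaces integration of matrices. -/
theorem monotoneOn_re_quadraticForm {n : ℕ} (g g' : ℂ → ℂ) (hg : ∀ z, HasDerivAt g (g' z) z)
    (B D : Matrix (Fin n) (Fin n) ℂ) (x : Fin n → ℂ)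
    (hpos : ∀ s ∈ Set.Icc (0 : ℝ) 1,
      (Matrix.hadamard D (entrywise g' (B + s • D))).PosSemidef) :
    MonotoneOn (fun s : ℝ => (star x ⬝ᵥ ((entrywise g (B + s • D)).mulVec x)).re)
      (Set.Icc 0 1) := by
  have hderiv : ∀ s : ℝ, HasDerivAt
      (fun s : ℝ => (star x ⬝ᵥ ((entrywise g (B + s • D)).mulVec x)).re)
      (star x ⬝ᵥ ((Matrix.hadamard D (entrywise g' (B + s • D))).mulVec x)).re s := by
    intro s
    have h : HasDerivAt (fun s : ℝ => star x ⬝ᵥ ((entrywise g (B + s • D)).mulVec x))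
        (star x ⬝ᵥ ((Matrix.hadamard D (entrywise g' (B + s • D))).mulVec x)) s := by
      simp_rw [star_dotProduct_mulVec_eq_sum]
      refine HasDerivAt.fun_sum fun k _ => HasDerivAt.fun_sum fun l _ => ?_
      refine HasDerivAt.mul_const (HasDerivAt.const_mul _ ?_) _
      have hin : HasDerivAt (fun s : ℝ => B k l + s • D k l) (D k l) s := by
        simpa using ((hasDerivAt_id s).smul_const (D k l)).const_add (B k l)
      have := (hg (B k l + s • D k l)).scomp s hin
      simpa [entrywise, Function.comp_def] using this
    exact (Complex.reCLM.hasFDerivAt.comp_hasDerivAt s h)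
  refine monotoneOn_of_deriv_nonneg (convex_Icc 0 1)
    (fun s _ => (hderiv s).continuousAt.continuousWithinAt)
    (fun s _ => (hderiv s).differentiableAt.differentiableWithinAt) fun s hs => ?_
  rw [interior_Icc] at hs
  rw [(hderiv s).deriv]
  exact (Complex.nonneg_iff.mp
    ((hpos s (Set.Ioo_subset_Icc_self hs)).dotProduct_mulVec_nonneg x)).1

theorem norm_le_sqrt_of_sub_vecMulVec_posSemidef {n : ℕ} {ρ : ℝ}
    {A : Matrix (Fin n) (Fin n) ℂ} (hA : A ∈ psdMatrices n (Metric.closedBall (0 : ℂ) ρ))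
    {u : Fin n → ℂ} (hu : (A - Matrix.vecMulVec u (star u)).PosSemidef) (k : Fin n) :
    ‖u k‖ ≤ √ρ := by
  have h := (Complex.nonneg_iff.mp (hu.diag_nonneg (i := k))).1
  have h2 : (u k * star (u k)).re = ‖u k‖ ^ 2 := by
    have := Complex.mul_conj' (u k)
    rw [← Complex.ofReal_pow] at this
    exact (congrArg Complex.re this).trans (Complex.ofReal_re _)
  rw [Matrix.sub_apply, Matrix.vecMulVec_apply, Pi.star_apply, Complex.sub_re, h2] at h
  have h3 : ‖A k k‖ ≤ ρ := by simpa using hA.2 k k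
  exact Real.le_sqrt_of_sq_le (by linarith [Complex.re_le_norm (A k k)])

/-- If the derivative preserves positivity in dimension `N`, then `f[A] - f[uu*] ≥ 0` in
dimension `N + 1`, where `uu*` is the rank one part of `A` carrying its `i`-th column. -/
theorem entrywise_sub_rankOne_posSemidef {N M : ℕ} (c : Fin (N + 1) → ℝ) {ρ t : ℝ} (hρ : 0 < ρ)
    (hder : ∀ A ∈ psdMatrices N (Metric.closedBall (0 : ℂ) ρ),
      (entrywise (perturbedPoly (fun j : Fin N => ((j : ℕ) + 1) * c j.succ) (t * (M + 1)) M)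
        A).PosSemidef)
    {A : Matrix (Fin (N + 1)) (Fin (N + 1)) ℂ}
    (hA : A ∈ psdMatrices (N + 1) (Metric.closedBall (0 : ℂ) ρ)) (i : Fin (N + 1))
    {u : Fin (N + 1) → ℂ} (hu : (A - Matrix.vecMulVec u (star u)).PosSemidef)
    (hui : ∀ k, u k * star (u i) = A k i) :
    (entrywise (perturbedPoly c t (M + 1)) A -
      entrywise (perturbedPoly c t (M + 1)) (Matrix.vecMulVec u (star u))).PosSemidef := by
  set B := Matrix.vecMulVec u (star u) with hB
  have hBpsd : B.PosSemidef := Matrix.posSemidef_vecMulVec_self_star u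
  have huρ := norm_le_sqrt_of_sub_vecMulVec_posSemidef hA hu
  have hBρ : ∀ k l, ‖B k l‖ ≤ ρ := fun k l => by
    rw [hB, Matrix.vecMulVec_apply, norm_mul, Pi.star_apply, norm_star, ← Real.mul_self_sqrt hρ.le]
    exact mul_le_mul (huρ k) (huρ l) (norm_nonneg _) (Real.sqrt_nonneg _)
  have hcol : ∀ k, (A - B) k i = 0 := fun k => by
    rw [Matrix.sub_apply, hB, Matrix.vecMulVec_apply, Pi.star_apply, hui, sub_self]
  have hrow : ∀ k, (A - B) i k = 0 := fun k => by
    rw [← hu.1.apply i k, hcol, star_zero]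
  have hherm : (entrywise (perturbedPoly c t (M + 1)) A -
      entrywise (perturbedPoly c t (M + 1)) B).IsHermitian :=
    (entrywise_perturbedPoly_isHermitian c t _ hA.1.1).sub
      (entrywise_perturbedPoly_isHermitian c t _ hBpsd.1)
  refine .of_dotProduct_mulVec_nonneg hherm fun x => ?_
  have hmono := monotoneOn_re_quadraticForm _ _ (hasDerivAt_perturbedPoly c t M) B (A - B) x
    fun s hs => by
      -- As a convex combination of `B` and `A`, the segment stays positive semidefinite with
      -- entries in the disc.
      have hconv : B + s • (A - B) = (1 - s) • B + s • A := by
        rw [smul_sub, sub_smul, one_smul]; abel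
      refine posSemidef_of_zero_row i (fun k => ?_) (fun k => ?_) ?_
      · rw [Matrix.hadamard_apply, hrow, zero_mul]
      · rw [Matrix.hadamard_apply, hcol, zero_mul]
      · refine Matrix.PosSemidef.hadamard (hu.submatrix i.succAbove)
          (hder ((B + s • (A - B)).submatrix i.succAbove i.succAbove) ⟨?_, fun k l => ?_⟩)
        · rw [hconv]
          exact (((hBpsd.smul (sub_nonneg.mpr hs.2)).add (hA.1.smul hs.1))).submatrix _
        · rw [hconv]
          exact (convex_closedBall (0 : ℂ) ρ) (by simpa using hBρ _ _) (hA.2 _ _)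
            (sub_nonneg.mpr hs.2) hs.1 (sub_add_cancel 1 s)
  have hle := hmono (Set.left_mem_Icc.mpr zero_le_one) (Set.right_mem_Icc.mpr zero_le_one)
    zero_le_one
  simp only [zero_smul, add_zero, one_smul, add_sub_cancel] at hle
  rw [Complex.nonneg_iff]
  refine ⟨?_, (hherm.im_star_dotProduct_mulVec_self x).symm⟩
  rw [Matrix.sub_mulVec, dotProduct_sub, Complex.sub_re]
  exact sub_nonneg.mpr hle

/-- The `j = 0` term on the right is dropped and the rest compared termwise, using `(M+1) binom(M,
j) = (j+1) binom(M+1, j+1)` and `j + 1 ≤ M + 1`. -/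
theorem threshold_deriv_le {N M : ℕ} (hNM : N ≤ M) (c : Fin (N + 1) → ℝ) (hc : ∀ j, 0 < c j)
    {ρ : ℝ} (hρ : 0 < ρ) :
    (M + 1) * threshold (fun j : Fin N => ((j : ℕ) + 1) * c j.succ) M ρ ≤
      threshold c (M + 1) ρ := by
  unfold threshold
  rw [Fin.sum_univ_succ, Finset.mul_sum]
  have h0 := hc 0
  refine le_add_of_nonneg_of_le (by positivity) (Finset.sum_le_sum fun j _ => ?_)
  have hcj := hc j.succ
  have e1 : M + 1 - (j.succ : ℕ) = M - j := by simp
  have e2 : N + 1 - (j.succ : ℕ) = N - j := by simp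
  rw [e1, e2, Fin.val_succ]
  have hch : (M + 1 : ℝ) * M.choose (j : ℕ) = (M + 1).choose ((j : ℕ) + 1) * ((j : ℕ) + 1) := by
    exact_mod_cast Nat.add_one_mul_choose_eq M j
  have hjM : ((j : ℕ) : ℝ) + 1 ≤ M + 1 := by
    have := j.2
    exact_mod_cast (by omega : (j : ℕ) + 1 ≤ M + 1)
  have hM : (0 : ℝ) < M + 1 := by positivity
  have hj : (0 : ℝ) < (j : ℕ) + 1 := by positivity
  have key : (M + 1 : ℝ) * (M.choose (j : ℕ) : ℝ) ^ 2 / ((j : ℕ) + 1) ≤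
      ((M + 1).choose ((j : ℕ) + 1) : ℝ) ^ 2 := by
    rw [div_le_iff₀ hj]
    refine le_of_mul_le_mul_left ?_ hM
    calc (M + 1 : ℝ) * ((M + 1) * (M.choose (j : ℕ) : ℝ) ^ 2)
        = ((M + 1).choose ((j : ℕ) + 1) * ((j : ℕ) + 1)) ^ 2 := by rw [← hch]; ring
      _ = ((M + 1).choose ((j : ℕ) + 1) : ℝ) ^ 2 * ((j : ℕ) + 1) * ((j : ℕ) + 1) := by ring
      _ ≤ ((M + 1).choose ((j : ℕ) + 1) : ℝ) ^ 2 * ((j : ℕ) + 1) * (M + 1) := by gcongr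
      _ = _ := by ring
  calc _ = (M + 1 : ℝ) * (M.choose (j : ℕ) : ℝ) ^ 2 / ((j : ℕ) + 1) *
        ((M - (j : ℕ) - 1).choose (N - (j : ℕ) - 1) : ℝ) ^ 2 * (ρ ^ (M - (j : ℕ)) / c j.succ) := by
        field_simp
    _ ≤ _ := by gcongr

/-- Entrywise positivity preservation in fixed dimension for polynomials with one negative
coefficient. -/
theorem entrywise_perturbedPoly_posSemidef {N M : ℕ} (hNM : N ≤ M) (c : Fin N → ℝ)
    (hc : ∀ j, 0 < c j) {ρ t : ℝ} (hρ : 0 < ρ) (ht : 0 ≤ t) (htc : t * threshold c M ρ ≤ 1)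
    (A : Matrix (Fin N) (Fin N) ℂ) (hA : A ∈ psdMatrices N (Metric.closedBall (0 : ℂ) ρ)) :
    (entrywise (perturbedPoly c t M) A).PosSemidef := by
  induction N generalizing M t with
  | zero =>
    rw [Subsingleton.elim (entrywise (perturbedPoly c t M) A) 0]
    exact .zero
  | succ N ih =>
    obtain ⟨M, rfl⟩ : ∃ M', M = M' + 1 := ⟨M - 1, by omega⟩
    obtain ⟨u, hu, hui⟩ := exists_rankOne_sub_posSemidef hA.1 0
    -- A free `t` is essential: `t (M + 1)` need not be the reciprocal of the threshold of `f'`, but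
    -- their product is at most `1`.
    have h1 := entrywise_sub_rankOne_posSemidef c hρ (t := t) (M := M) (fun A' hA' =>
      ih (by omega) _ (fun j => mul_pos (by positivity) (hc _)) (by positivity)
        (by
          rw [mul_assoc]
          exact (mul_le_mul_of_nonneg_left (threshold_deriv_le (by omega) c hc hρ) ht).trans htc)
        A' hA') hA 0 hu hui
    have h2 := perturbedPoly_rankOne_posSemidef hNM c hc hρ ht htc u
      (norm_le_sqrt_of_sub_vecMulVec_posSemidef hA hu)
    simpa using h1.add h2

theorem entrywise_perturbedPoly_posDef {N M : ℕ} (hN : 1 < N) (hNM : N ≤ M) (c : Fin N → ℝ)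
    (hc : ∀ j, 0 < c j) {ρ t : ℝ} (hρ : 0 < ρ) (ht : 0 ≤ t) (htc : t * threshold c M ρ ≤ 1)
    (A : Matrix (Fin N) (Fin N) ℂ) (hA : A ∈ psdMatrices N (Metric.closedBall (0 : ℂ) ρ))
    (i : Fin N) (hinj : Function.Injective fun k => A k i) :
    (entrywise (perturbedPoly c t M) A).PosDef := by
  obtain ⟨N, rfl⟩ : ∃ N', N = N' + 1 := ⟨N - 1, by omega⟩
  obtain ⟨M, rfl⟩ : ∃ M', M = M' + 1 := ⟨M - 1, by omega⟩
  obtain ⟨u, hu, hui⟩ := exists_rankOne_sub_posSemidef hA.1 i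
  have h1 := entrywise_sub_rankOne_posSemidef c hρ (t := t) (M := M)
    (entrywise_perturbedPoly_posSemidef (by omega) _
      (fun j => mul_pos (by positivity) (hc _)) hρ (by positivity) (by
        rw [mul_assoc]
        exact (mul_le_mul_of_nonneg_left (threshold_deriv_le (by omega) c hc hρ) ht).trans htc))
    hA i hu hui
  have h2 := perturbedPoly_rankOne_posDef hN hNM c hc hρ ht htc u
    (norm_le_sqrt_of_sub_vecMulVec_posSemidef hA hu)
    -- Column `i` is `u` times the scalar `star (u i)`, so its distinct entries force distinct `u
    -- k`.
    fun k l hkl => hinj (by simp only [← hui, hkl])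
  simpa using h2.posSemidef_add h1

/-! ### Positivity of the threshold and the equality case -/

theorem threshold_term_pos {N : ℕ} (c : Fin N → ℝ) (hc : ∀ j, 0 < c j) {M : ℕ} (hNM : N ≤ M)
    {ρ : ℝ} (hρ : 0 < ρ) (j : Fin N) :
    0 < (M.choose (j : ℕ) : ℝ) ^ 2 * ((M - (j : ℕ) - 1).choose (N - (j : ℕ) - 1) : ℝ) ^ 2 *
      (ρ ^ (M - (j : ℕ)) / c j) := by
  have := j.2
  have h1 : 0 < M.choose (j : ℕ) := Nat.choose_pos (by omega)
  have h2 : 0 < (M - (j : ℕ) - 1).choose (N - (j : ℕ) - 1) := Nat.choose_pos (by omega)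
  have h3 := hc j
  positivity

/-- The `j = 0` term of the threshold is already at least `ρ^M / c_0`; the `j = 1` term, present as
`N > 1`, makes the inequality strict. -/
theorem pow_lt_threshold_mul {N : ℕ} (hN : 1 < N) {M : ℕ} (hNM : N ≤ M) (c : Fin N → ℝ)
    (hc : ∀ j, 0 < c j) {ρ : ℝ} (hρ : 0 < ρ) :
    ρ ^ M < threshold c M ρ * c ⟨0, by omega⟩ := by
  set z : Fin N := ⟨0, by omega⟩ with hz
  have hlt : ρ ^ M / c z < threshold c M ρ := by
    refine lt_of_le_of_lt ?_ (Finset.single_lt_sum (i := z) (j := ⟨1, hN⟩) (by simp [hz])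
      (Finset.mem_univ _) (Finset.mem_univ _) (threshold_term_pos c hc hNM hρ _)
      fun j _ _ => (threshold_term_pos c hc hNM hρ j).le)
    have h2 : 1 ≤ (M - (z : ℕ) - 1).choose (N - (z : ℕ) - 1) := Nat.choose_pos (by simp [hz]; omega)
    have h2' : (1 : ℝ) ≤ ((M - (z : ℕ) - 1).choose (N - (z : ℕ) - 1) : ℝ) ^ 2 :=
      one_le_pow₀ (by exact_mod_cast h2)
    have h3 := hc z
    have e : (z : ℕ) = 0 := rfl
    rw [e] at h2' ⊢
    simp only [Nat.choose_zero_right, Nat.cast_one, one_pow, one_mul, Nat.sub_zero] at h2' ⊢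
    exact le_mul_of_one_le_left (by positivity) h2'
  rwa [div_lt_iff₀ (hc z)] at hlt

theorem threshold_fin_one (c : Fin 1 → ℝ) (M : ℕ) (ρ : ℝ) : threshold c M ρ = ρ ^ M / c 0 := by
  simp [threshold]

/-- With `a` the first diagonal entry and `C` the threshold, `a^M ≤ ρ^M < C c_0 ≤ C ∑ c_j a^j`. -/
theorem hadamardPow_ne_of_one_lt {N M : ℕ} (hN : 1 < N) (hNM : N ≤ M) (c : Fin N → ℝ)
    (hc : ∀ j, 0 < c j) {ρ : ℝ} (hρ : 0 < ρ) {A : Matrix (Fin N) (Fin N) ℂ}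
    (hA : A ∈ psdMatrices N (Metric.closedBall (0 : ℂ) ρ)) :
    hadamardPow A M ≠ threshold c M ρ • ∑ j : Fin N, c j • hadamardPow A (j : ℕ) := by
  intro h
  set z : Fin N := ⟨0, by omega⟩ with hz
  obtain ⟨a, ha⟩ : ∃ a : ℝ, A z z = a :=
    ⟨(A z z).re, Complex.ext rfl (by simp [← (Complex.nonneg_iff.mp hA.1.diag_nonneg).2])⟩
  have ha0 : 0 ≤ a := by simpa [ha] using hA.1.diag_nonneg (i := z)
  have haρ : a ≤ ρ := by simpa [ha, abs_of_nonneg ha0] using hA.2 z z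
  have h1 := congrFun (congrFun h z) z
  simp only [hadamardPow, entrywise, Matrix.of_apply, Matrix.smul_apply, Matrix.sum_apply, ha,
    Complex.real_smul] at h1
  have h2 : a ^ M = threshold c M ρ * ∑ j : Fin N, c j * a ^ (j : ℕ) := by exact_mod_cast h1
  have hth : 0 ≤ threshold c M ρ :=
    Finset.sum_nonneg fun j _ => (threshold_term_pos c hc hNM hρ j).le
  have h3 : c z ≤ ∑ j : Fin N, c j * a ^ (j : ℕ) := by
    have := Finset.single_le_sum (f := fun j : Fin N => c j * a ^ (j : ℕ))
      (fun j _ => mul_nonneg (hc j).le (pow_nonneg ha0 _)) (Finset.mem_univ z)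
    simpa [hz] using this
  have h4 := pow_lt_threshold_mul hN hNM c hc hρ
  have h5 : a ^ M ≤ ρ ^ M := by gcongr
  have h6 := mul_le_mul_of_nonneg_left h3 hth
  linarith

theorem hadamardPow_eq_iff_fin_one {M : ℕ} (hM : M ≠ 0) (c : Fin 1 → ℝ) (hc : 0 < c 0) {ρ : ℝ}
    (hρ : 0 < ρ) {A : Matrix (Fin 1) (Fin 1) ℂ} (hA : A.PosSemidef) :
    hadamardPow A M = threshold c M ρ • ∑ j : Fin 1, c j • hadamardPow A (j : ℕ) ↔
      A = Matrix.of fun _ _ => (ρ : ℂ) := by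
  obtain ⟨a, ha⟩ : ∃ a : ℝ, A 0 0 = a :=
    ⟨(A 0 0).re, Complex.ext rfl (by simp [← (Complex.nonneg_iff.mp hA.diag_nonneg).2])⟩
  have ha0 : 0 ≤ a := by simpa [ha] using hA.diag_nonneg (i := 0)
  have hc' : (c 0 : ℂ) ≠ 0 := by exact_mod_cast hc.ne'
  have h1 : hadamardPow A M = threshold c M ρ • ∑ j : Fin 1, c j • hadamardPow A (j : ℕ) ↔
      a ^ M = ρ ^ M := by
    rw [← Matrix.ext_iff, threshold_fin_one]
    simp only [Fin.forall_fin_one, hadamardPow, entrywise, Matrix.of_apply, Matrix.smul_apply,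
      Fin.sum_univ_one, ha, Complex.real_smul]
    push_cast
    simp only [Fin.val_zero, pow_zero, mul_one, div_mul_cancel₀ _ hc']
    exact_mod_cast Iff.rfl
  rw [h1, pow_left_inj₀ ha0 hρ.le hM, ← Matrix.ext_iff]
  simp [Fin.forall_fin_one, ha]

theorem theorem3p2 (ρ : ℝ) (hρ : 0 < ρ) (N M : ℕ) (hN : 1 ≤ N) (hNM : N ≤ M)
    (c : Fin N → ℝ) (hc : ∀ j, 0 < c j) :
    (1 < N → ∀ A ∈ psdMatrices N (Metric.closedBall (0 : ℂ) ρ),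
      ((∃ i, Function.Injective fun j => A i j) ∨ (∃ j, Function.Injective fun i => A i j)) →
        (entrywise (extremalPoly c M ρ) A).PosDef) ∧
    (∀ A ∈ psdMatrices N (Metric.closedBall (0 : ℂ) ρ),
      hadamardPow A M = threshold c M ρ • ∑ j : Fin N, c j • hadamardPow A (j : ℕ) ↔
        N = 1 ∧ A = Matrix.of fun _ _ => (ρ : ℂ)) := by
  refine ⟨fun hN1 A hA hinj => ?_, fun A hA => ?_⟩
  · have hth : 0 < threshold c M ρ := Finset.sum_pos
      (fun j _ => threshold_term_pos c hc hNM hρ j) ⟨⟨0, hN⟩, Finset.mem_univ _⟩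
    obtain ⟨i, hi⟩ : ∃ i, Function.Injective fun k => A k i := by
      rcases hinj with ⟨i, hi⟩ | h
      · refine ⟨i, fun k l hkl => hi ?_⟩
        simpa only [hA.1.1.apply] using congrArg star hkl
      · exact h
    -- `extremalPoly` unfolds to `perturbedPoly` with `t` the inverse of the threshold.
    exact entrywise_perturbedPoly_posDef hN1 hNM c hc hρ (inv_nonneg.mpr hth.le)
      (inv_mul_cancel₀ hth.ne').le A hA i hi
  · rcases hN.eq_or_lt with rfl | hN1
    · rw [hadamardPow_eq_iff_fin_one (by omega) c (hc 0) hρ hA.1]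
      simp
    · exact ⟨fun h => absurd h (hadamardPow_ne_of_one_lt hN1 hNM c hc hρ hA),
        fun h => absurd h.1 (by omega)⟩
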